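/- Mean-field Blume–Capel model near the tricritical point. Let $\rho=\tfrac13(\delta_{-1}+\delta_0+\delta_1)$, let $\rho_\beta(d\omega)=e^{-\beta\omega^2}\rho(d\omega)\big/\int e^{-\beta s^2}\rho(ds)$, and let $$c_\beta(t)=\log\int e^{t\omega}\rho_\beta(d\omega)=\log\frac{1+e^{-\beta}(e^t+e^{-t})}{1+2e^{-\beta}} ,\qquad J_\beta(x)=\sup_{t\in\mathbb R}\{tx-c_\beta(t)\}\quad(x\in[-1,1]).$$ For $\beta,K>0$ let $I_{\beta,K}(x)=J_\beta(x)-\beta Kx^2-\inf_{y\in[-1,1]}\{J_\beta(y)-\beta Ky^2\}$, let $\mathcal M_{\beta,K}=\{x\in[-1,1]: I_{\beta,K}(x)=0\}$ be the set of equilibrium macrostates, and let $m(\beta,K)=\max\mathcal M_{\beta,K}$ be the magnetization (in the phase-coexistence region it is the positive element of $\mathcal M_{\beta,K}$). For $x\in\mathbb R$ let $G_{\beta,K}(x)=\beta Kx^2-c_\beta(2\beta Kx)$ be the free-energy functional. Put $K(\beta)=(e^\beta+2)/(4\beta)$, $\beta_c=\log 4$ and $c_4=3/16$. **Theorem 5.4.**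 Let $p\ge3$ be an integer, $\alpha>0$, and let $\ell\ne K^{(p)}(\beta_c)$ be real. For positive integers $n$ define $$\beta_n=\beta_c-\frac1{n^\alpha},\qquad K_n=K(\beta_c)+\sum_{j=1}^{p-1}\frac{K^{(j)}(\beta_c)(-1)^j}{j!\,n^{j\alpha}}+\frac{\ell(-1)^p}{p!\,n^{p\alpha}} .$$ Then $(\beta_n,K_n)$ converges to the tricritical point $(\beta_c,K(\beta_c))$, and the following hold. (a) With $u=1-(2p-1)\alpha$ and $\gamma=(p-1)\alpha/2$, $$n^{1-u}\,G_{\beta_n,K_n}(x/n^\gamma)\;\longrightarrow\; g(x)=\frac1{p!}\,\beta_c\,(K^{(p)}(\beta_c)-\ell)(-1)^p\,x^2+4c_4x^4\qquad(n\to\infty)$$ uniformly for $x$ in compact subsets of $\mathbb R$. (b) The polynomial $g$ has nonzero global minimum points if and only if $(K^{(p)}(\beta_c)-\ell)(-1)^p<0$. If this inequality holds, then the global minimum points of $g$ are exactly $\pm\bar x$, where $$\bar x=\left(\frac{\beta_c\,(\ell-K^{(p)}(\beta_c))(-1)^p}{8c_4\,p!}\right)^{1/2}.$$ (c) Assume $(K^{(p)}(\beta_c)-\ell)(-1)^p<0$.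 Then for all sufficiently large $n$ one has $K_n>K(\beta_n)$, $m(\beta_n,K_n)>0$ and $\mathcal M_{\beta_n,K_n}=\{\pm m(\beta_n,K_n)\}$. Moreover $m(\beta_n,K_n)\to0$, with $$m(\beta_n,K_n)\sim\frac{\bar x}{n^{(p-1)\alpha/2}}=\bar x\,(\beta_c-\beta_n)^{(p-1)/2},\qquad\text{i.e.}\qquad \lim_{n\to\infty}n^{(p-1)\alpha/2}\,m(\beta_n,K_n)=\bar x .$$ -/

import Mathlib

open Filter Topology MeasureTheory ProbabilityTheory
open scoped Nat

namespace BlumeCapel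

noncomputable section

/-- The uniform single-spin law `ρ = (1/3)(δ₋₁ + δ₀ + δ₁)` on the spin values `{-1, 0, 1}`. -/
def spinLaw : Measure ℝ :=
  (3 : ENNReal)⁻¹ • (Measure.dirac (-1) + Measure.dirac 0 + Measure.dirac 1)

/-- The law `ρ_β(dω) = exp(-β ω²) ρ(dω) / Z(β)`, where `Z(β) = ∫ exp(-β ω²) ρ(dω)`. -/
def tiltedSpinLaw (β : ℝ) : Measure ℝ :=
  spinLaw.tilted (fun ω => -β * ω ^ 2)

/-- The cumulant generating function `c_β(t) = log ∫ exp(t ω) ρ_β(dω)`. -/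
def cumulant (β t : ℝ) : ℝ :=
  cgf id (tiltedSpinLaw β) t

theorem integral_spinLaw (f : ℝ → ℝ) :
    ∫ x, f x ∂spinLaw = (f (-1) + f 0 + f 1) / 3 := by
  have h : ∀ a : ℝ, Integrable f (Measure.dirac a) := fun a => integrable_dirac (by simp)
  rw [spinLaw, integral_smul_measure,
    integral_add_measure ((h _).add_measure (h _)) (h _), integral_add_measure (h _) (h _)]
  simp only [integral_dirac, ENNReal.toReal_inv, ENNReal.toReal_ofNat, smul_eq_mul]
  ring

theorem cumulant_eq (β t : ℝ) :
    cumulant β t =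
      Real.log ((1 + Real.exp (-β) * (Real.exp t + Real.exp (-t))) / (1 + 2 * Real.exp (-β))) := by
  have hm : mgf id (tiltedSpinLaw β) t =
      (1 + Real.exp (-β) * (Real.exp t + Real.exp (-t))) / (1 + 2 * Real.exp (-β)) := by
    rw [mgf, tiltedSpinLaw, integral_exp_tilted, integral_spinLaw, integral_spinLaw]
    have hpos : (1 + 2 * Real.exp (-β)) ≠ 0 := by positivity
    have h1 : Real.exp (-β + t) = Real.exp (-β) * Real.exp t := Real.exp_add _ _
    have h2 : Real.exp (-β + -t) = Real.exp (-β) * Real.exp (-t) := Real.exp_add _ _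
    simp only [Pi.add_apply, id, neg_one_sq, mul_one, mul_neg, one_pow, ne_eq, OfNat.ofNat_ne_zero,
      not_false_eq_true, zero_pow, mul_zero, add_zero, Real.exp_zero, h1, h2]
    have hpos' : (Real.exp (-β) + 1 + Real.exp (-β)) ≠ 0 := by positivity
    field_simp
    ring
  rw [cumulant, cgf, hm]

/-- The Legendre-Fenchel transform `J_β(x) = sup_t (t x - c_β(t))`, to be used for `x ∈ [-1, 1]`,
where the supremum is finite. -/
def legendre (β x : ℝ) : ℝ :=
  ⨆ t : ℝ, (t * x - cumulant β t)

theorem bddAbove_legendre (β : ℝ) {x : ℝ} (hx : x ∈ Set.Icc (-1 : ℝ) 1) :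
    BddAbove (Set.range fun t : ℝ => t * x - cumulant β t) := by
  refine ⟨Real.log (1 + 2 * Real.exp (-β)) + β, ?_⟩
  rintro _ ⟨t, rfl⟩
  have hE := Real.exp_pos (-β)
  have hkey : t * x - β ≤ Real.log (1 + Real.exp (-β) * (Real.exp t + Real.exp (-t))) := by
    rw [Real.le_log_iff_exp_le (by positivity)]
    have h1 : t * x ≤ |t| := by
      calc t * x ≤ |t * x| := le_abs_self _
        _ = |t| * |x| := abs_mul _ _
        _ ≤ |t| * 1 := by gcongr; exact abs_le.mpr hx
        _ = |t| := mul_one _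
    have h2 : Real.exp |t| ≤ Real.exp t + Real.exp (-t) := by
      rcases abs_cases t with ⟨h, _⟩ | ⟨h, _⟩ <;> rw [h] <;>
        linarith [Real.exp_pos t, Real.exp_pos (-t)]
    calc Real.exp (t * x - β) ≤ Real.exp (-β + |t|) := Real.exp_le_exp.mpr (by linarith)
      _ = Real.exp (-β) * Real.exp |t| := Real.exp_add _ _
      _ ≤ Real.exp (-β) * (Real.exp t + Real.exp (-t)) := by gcongr
      _ ≤ _ := by linarith
  simp only [cumulant_eq]
  rw [Real.log_div (by positivity) (by positivity)]
  linarith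

/-- The large deviation rate function of the spin per site,
`I_{β,K}(x) = J_β(x) - β K x² - inf_{y ∈ [-1,1]} (J_β(y) - β K y²)`, for `x ∈ [-1, 1]`. -/
def rate (β K x : ℝ) : ℝ :=
  legendre β x - β * K * x ^ 2 -
    sInf ((fun y : ℝ => legendre β y - β * K * y ^ 2) '' Set.Icc (-1) 1)

/-- The set `M_{β,K}` of equilibrium macrostates (equilibrium values of the magnetization). -/
def equilibria (β K : ℝ) : Set ℝ :=
  {x | x ∈ Set.Icc (-1 : ℝ) 1 ∧ rate β K x = 0}

/-- The magnetization `m(β,K)`: the largest equilibrium macrostate. In the phase-coexistence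
region, where `M_{β,K}` is `{±m}` or `{0, ±m}` with `m > 0`, it is the positive element `m`. -/
def magnetization (β K : ℝ) : ℝ :=
  sSup (equilibria β K)

/-- The free-energy functional `G_{β,K}(x) = β K x² - c_β(2 β K x)`. -/
def freeEnergy (β K x : ℝ) : ℝ :=
  β * K * x ^ 2 - cumulant β (2 * β * K * x)

/-- The critical inverse temperature `β_c = log 4`. -/
def betaC : ℝ := Real.log 4

/-- The function `K(β) = (e^β + 2) / (4 β)`; for `0 < β < β_c` its graph is the second-order
curve, and `(β_c, K(β_c))` is the tricritical point. -/
def Kcurve (β : ℝ) : ℝ := (Real.exp β + 2) / (4 * β)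

/-- The derivative `K^{(j)}(β_c)` of order `j`. -/
def KcurveDeriv (j : ℕ) : ℝ := iteratedDeriv j Kcurve betaC

/-- `β_n = β_c - 1 / n^α`. -/
def betaSeq (α : ℝ) (n : ℕ) : ℝ := betaC - 1 / (n : ℝ) ^ α

/-- `K_n = K(β_c) + ∑_{j=1}^{p-1} K^{(j)}(β_c) (-1)^j / (j! n^{jα}) + ℓ (-1)^p / (p! n^{pα})`. -/
def KSeq (p : ℕ) (α ℓ : ℝ) (n : ℕ) : ℝ :=
  Kcurve betaC
    + ∑ j ∈ Finset.Icc 1 (p - 1),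
        KcurveDeriv j * (-1) ^ j / ((j ! : ℝ) * (n : ℝ) ^ ((j : ℝ) * α))
    + ℓ * (-1) ^ p / ((p ! : ℝ) * (n : ℝ) ^ ((p : ℝ) * α))

/-- The constant `c₄ = 3/16`. -/
def c4 : ℝ := 3 / 16

/-- The Ginzburg-Landau polynomial
`g(x) = (1/p!) β_c (K^{(p)}(β_c) - ℓ) (-1)^p x² + 4 c₄ x⁴`. -/
def ginzburgLandau (p : ℕ) (ℓ x : ℝ) : ℝ :=
  1 / (p ! : ℝ) * betaC * (KcurveDeriv p - ℓ) * (-1) ^ p * x ^ 2 + 4 * c4 * x ^ 4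

/-- `x̄ = (β_c (ℓ - K^{(p)}(β_c)) (-1)^p / (8 c₄ p!))^{1/2}`. -/
def xbar (p : ℕ) (ℓ : ℝ) : ℝ :=
  Real.sqrt (betaC * (ℓ - KcurveDeriv p) * (-1) ^ p / (8 * c4 * (p ! : ℝ)))

/-- The set of global minimum points of a real function. -/
def globalMinPoints (f : ℝ → ℝ) : Set ℝ := {x | ∀ y, f x ≤ f y}

end

end BlumeCapel

/-! With `a = 2/(e^β + 2)` one has `c_β(t) = log (1 + a (cosh t - 1))`, and `β ≤ β_c` means `a ≥
1/3`. Two facts combine.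

Shape. For `1/3 ≤ a < 1` the mean `c_β'` is strictly concave on `[0, ∞)`. Hence, once `K > K(β)`,
the mean-field equation `c_β'(2βKm) = m` has exactly one positive solution, and `G` decreases up to
it and increases afterwards (`exists_freeEnergy_unimodal`). Since `G ≤ J_β - βKx²` on `[-1, 1]`,
with equality at mean-field solutions, `±m` are the equilibria (`equilibria_eq_pair`).

Scale. The quadratic coefficient of `G` is a multiple of `K(β) - K`. As `K_n` is the Taylor
polynomial of `K` at `β_c` with its last coefficient changed to `ℓ`, this gap has order `n^(-pα)`.
The quartic coefficient is a multiple of `a(3a - 1)`, which vanishes linearly at `β_c`, so it has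
order `n^(-α)`. The scaling in (a) makes both converge to constants and leaves a sixth order
remainder of order `n^(-(p-2)α)`.

Unimodality then transfers minimum points to the limit using pointwise convergence only
(`tendsto_scaled_minPoint`). -/

namespace BlumeCapel

/-! ### Cumulant generating function and mean of the spin law -/

/-- The variance `c_β''(0) = 2 / (e^β + 2)` of the tilted single-spin law. -/
noncomputable def spinVariance (β : ℝ) : ℝ := 2 / (Real.exp β + 2)

/-- The cumulant generating function of the symmetric law on `{-1, 0, 1}` of variance `a`. -/
noncomputable def spinCgf (a t : ℝ) : ℝ := Real.log (1 + a * (Real.cosh t - 1))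

/-- The derivative of `spinCgf a`. -/
noncomputable def spinMean (a t : ℝ) : ℝ := a * Real.sinh t / (1 + a * (Real.cosh t - 1))

theorem spinVariance_pos (β : ℝ) : 0 < spinVariance β := by unfold spinVariance; positivity

theorem spinVariance_lt_one (β : ℝ) : spinVariance β < 1 := by
  unfold spinVariance
  rw [div_lt_one (by positivity)]
  linarith [Real.exp_pos β]

theorem one_third_le_spinVariance {β : ℝ} (hβ : β ≤ betaC) : 1 / 3 ≤ spinVariance β := by
  have h : Real.exp β ≤ 4 := by
    calc Real.exp β ≤ Real.exp (Real.log 4) := Real.exp_le_exp.mpr hβ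
      _ = 4 := Real.exp_log (by norm_num)
  unfold spinVariance
  rw [div_le_div_iff₀ (by norm_num) (by positivity)]
  linarith

theorem cumulant_eq_spinCgf (β t : ℝ) : cumulant β t = spinCgf (spinVariance β) t := by
  rw [cumulant_eq, spinCgf, spinVariance, Real.cosh_eq, Real.exp_neg β]
  congr 1
  have := Real.exp_pos β
  field_simp
  ring

theorem spinCgf_arg_pos {a : ℝ} (ha : 0 ≤ a) (t : ℝ) : 0 < 1 + a * (Real.cosh t - 1) := by
  nlinarith [Real.one_le_cosh t]

theorem spinCgf_neg (a t : ℝ) : spinCgf a (-t) = spinCgf a t := by simp [spinCgf]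

theorem hasDerivAt_spinCgf {a : ℝ} (ha : 0 ≤ a) (t : ℝ) :
    HasDerivAt (spinCgf a) (spinMean a t) t :=
  ((((Real.hasDerivAt_cosh t).sub_const 1).const_mul a).const_add 1).log
    (spinCgf_arg_pos ha t).ne'

theorem hasDerivAt_spinMean {a : ℝ} (ha : 0 ≤ a) (t : ℝ) :
    HasDerivAt (spinMean a)
      (a * (a + (1 - a) * Real.cosh t) / (1 + a * (Real.cosh t - 1)) ^ 2) t := by
  have h1 := (Real.hasDerivAt_sinh t).const_mul a
  have h2 := (((Real.hasDerivAt_cosh t).sub_const 1).const_mul a).const_add 1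
  refine (h1.div h2 (spinCgf_arg_pos ha t).ne').congr_deriv ?_
  congr 1
  linear_combination a ^ 2 * Real.cosh_sq t

theorem continuous_spinMean {a : ℝ} (ha : 0 ≤ a) : Continuous (spinMean a) :=
  continuous_iff_continuousAt.mpr fun t => (hasDerivAt_spinMean ha t).continuousAt

theorem spinMean_zero (a : ℝ) : spinMean a 0 = 0 := by simp [spinMean]

theorem strictMono_spinMean {a : ℝ} (ha : 0 < a) (ha1 : a < 1) : StrictMono (spinMean a) := by
  refine strictMono_of_deriv_pos fun t => ?_
  rw [(hasDerivAt_spinMean ha.le t).deriv]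
  have := spinCgf_arg_pos ha.le t
  have : 0 < 1 - a := by linarith
  have := Real.cosh_pos t
  positivity

theorem spinMean_lt_one {a : ℝ} (ha : 0 < a) (ha1 : a < 1) (t : ℝ) : spinMean a t < 1 := by
  rw [spinMean, div_lt_one (spinCgf_arg_pos ha.le t)]
  nlinarith [Real.sinh_lt_cosh t]

/-! ### Concavity of the mean and the mean-field equation -/

/-- This ratio is `c''` written in `y = cosh t`. Its derivative at `y = 1` has the sign of `1 - 3a`,
whence the threshold `1/3`. -/
theorem strictAntiOn_variance_ratio {a : ℝ} (ha : 1 / 3 ≤ a) (ha1 : a < 1) :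
    StrictAntiOn (fun y : ℝ => a * (a + (1 - a) * y) / (1 + a * (y - 1)) ^ 2) (Set.Ici 1) := by
  intro y hy z hz hyz
  have hy : 1 ≤ y := hy
  have hz : 1 ≤ z := hz
  have hD : ∀ w : ℝ, 1 ≤ w → 0 < 1 + a * (w - 1) := fun w hw => by nlinarith
  have h1 := hD y hy
  have h2 := hD z hz
  show a * (a + (1 - a) * z) / (1 + a * (z - 1)) ^ 2 < a * (a + (1 - a) * y) / (1 + a * (y - 1)) ^ 2
  rw [div_lt_div_iff₀ (by positivity) (by positivity)]
  have hb : 0 < 1 - a := by linarith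
  have hyz1 : 0 < y * z - 1 := by nlinarith
  have hyz2 : 0 < z + y - 2 := by linarith
  -- This is the exact factorisation of the cross-multiplied difference.
  have key : 0 < a * ((z - y) * (3 * a - 1 + (a ^ 3 * (z + y - 2) + a ^ 2 * (1 - a) * (y * z - 1)))) := by
    have : 0 < z - y := by linarith
    have : 0 ≤ 3 * a - 1 := by linarith
    have : 0 < a := by linarith
    positivity
  nlinarith [key]

theorem strictConcaveOn_spinMean {a : ℝ} (ha : 1 / 3 ≤ a) (ha1 : a < 1) :
    StrictConcaveOn ℝ (Set.Ici 0) (spinMean a) := by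
  have ha0 : 0 ≤ a := by linarith
  refine StrictAntiOn.strictConcaveOn_of_deriv (convex_Ici 0)
    (continuous_spinMean ha0).continuousOn ?_
  rw [interior_Ici]
  intro s hs t ht hst
  rw [(hasDerivAt_spinMean ha0 s).deriv, (hasDerivAt_spinMean ha0 t).deriv]
  exact strictAntiOn_variance_ratio ha ha1 (Real.one_le_cosh s) (Real.one_le_cosh t)
    (Real.cosh_strictMonoOn (Set.mem_Ici.mpr (Set.mem_Ioi.mp hs).le)
      (Set.mem_Ici.mpr (Set.mem_Ioi.mp ht).le) hst)

/-- The mean-field equation `c'(κ m) = m` has a positive solution `m` when `a κ > 1`, at which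
the function `m - c'(κ m)` changes its sign from negative to positive. -/
theorem exists_meanField_solution {a κ : ℝ} (ha : 1 / 3 ≤ a) (ha1 : a < 1) (hκ : 0 < κ)
    (haκ : 1 < a * κ) :
    ∃ m, 0 < m ∧ m < 1 ∧ spinMean a (κ * m) = m ∧
      (∀ x, 0 < x → x < m → x < spinMean a (κ * x)) ∧
      (∀ x, m < x → spinMean a (κ * x) < x) := by
  have ha0 : 0 < a := by linarith
  set h : ℝ → ℝ := fun x => spinMean a (κ * x) - x with hdef
  have hconc : StrictConcaveOn ℝ (Set.Ici 0) h := by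
    refine ⟨convex_Ici 0, fun x hx y hy hxy r s hr hs hrs => ?_⟩
    have hx : 0 ≤ x := hx
    have hy : 0 ≤ y := hy
    have := (strictConcaveOn_spinMean ha ha1).2 (x := κ * x) (y := κ * y)
      (Set.mem_Ici.mpr (by positivity)) (Set.mem_Ici.mpr (by positivity))
      (fun he => hxy (mul_left_cancel₀ hκ.ne' he)) hr hs hrs
    simp only [smul_eq_mul, hdef] at this ⊢
    rw [show κ * (r * x + s * y) = r * (κ * x) + s * (κ * y) by ring]
    linarith
  have hcont : Continuous h := by
    have := continuous_spinMean ha0.le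
    fun_prop
  have h0 : h 0 = 0 := by simp [hdef, spinMean_zero]
  have hder : HasDerivAt h (a * κ - 1) 0 := by
    have h1 : HasDerivAt (fun x : ℝ => κ * x) κ 0 := by
      simpa using (hasDerivAt_id (0 : ℝ)).const_mul κ
    have h2 : HasDerivAt (spinMean a) a (κ * 0) := by
      refine (hasDerivAt_spinMean ha0.le _).congr_deriv ?_
      simp
    exact (h2.comp 0 h1).sub (hasDerivAt_id 0)
  -- The slope `aκ - 1` of `h` at `0` is positive, so `h > 0` just to the right of `0`; together
  -- with `h 1 < 0` this brackets a root away from `0`.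
  obtain ⟨x₁, hx₁0, hx₁1, hx₁⟩ : ∃ x, 0 < x ∧ x < 1 ∧ 0 < h x := by
    have ht := hder.tendsto_slope_zero_right
    have he : ∀ᶠ t in 𝓝[>] (0 : ℝ), 0 < t⁻¹ • (h (0 + t) - h 0) :=
      ht.eventually (lt_mem_nhds (by linarith))
    have he1 : ∀ᶠ t in 𝓝[>] (0 : ℝ), t < 1 :=
      (tendsto_nhdsWithin_of_tendsto_nhds tendsto_id).eventually (gt_mem_nhds one_pos)
    obtain ⟨t, h1, h2, h3⟩ := (he.and (he1.and self_mem_nhdsWithin)).exists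
    have h3 : 0 < t := h3
    refine ⟨t, h3, h2, ?_⟩
    rw [zero_add, h0, sub_zero, smul_eq_mul] at h1
    exact (pos_iff_pos_of_mul_pos h1).mp (inv_pos.mpr h3)
  have h1neg : h 1 < 0 := by
    have := spinMean_lt_one ha0 ha1 (κ * 1)
    simp only [hdef]
    linarith
  obtain ⟨m, ⟨hm1, hm2⟩, hm⟩ : (0 : ℝ) ∈ h '' Set.Icc x₁ 1 :=
    intermediate_value_Icc' hx₁1.le hcont.continuousOn ⟨h1neg.le, hx₁.le⟩
  have hm0 : 0 < m := by linarith
  -- Here `x` is a proper convex combination of `0` and `y`, and `h 0 = 0`. This fixes the sign of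
  -- `h` on both sides of the root.
  have hpos : ∀ x, 0 < x → ∀ y, x < y → 0 ≤ h y → 0 < h x := by
    intro x hx y hxy hy
    have hy0 : 0 < y := hx.trans hxy
    have hr : 0 < 1 - x / y := by rw [sub_pos, div_lt_one hy0]; exact hxy
    have hs : 0 < x / y := by positivity
    have := hconc.2 (Set.mem_Ici.mpr le_rfl) (Set.mem_Ici.mpr hy0.le) hy0.ne hr hs (by ring)
    simp only [smul_eq_mul, mul_zero, zero_add, h0, div_mul_cancel₀ x hy0.ne'] at this
    exact lt_of_le_of_lt (by positivity) this
  refine ⟨m, hm0, ?_, ?_, ?_, ?_⟩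
  · refine lt_of_le_of_ne hm2 ?_
    rintro rfl
    linarith
  · simp only [hdef] at hm
    linarith
  · intro x hx hxm
    have := hpos x hx m hxm hm.ge
    simp only [hdef] at this
    linarith
  · intro x hxm
    by_contra! hcon
    have := hpos m hm0 x hxm (by simp only [hdef]; linarith)
    linarith

/-! ### Unimodality of the free energy -/

theorem freeEnergy_neg (β K x : ℝ) : freeEnergy β K (-x) = freeEnergy β K x := by
  rw [freeEnergy, freeEnergy, cumulant_eq_spinCgf, cumulant_eq_spinCgf, mul_neg, spinCgf_neg, neg_sq]

theorem hasDerivAt_freeEnergy (β K x : ℝ) :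
    HasDerivAt (freeEnergy β K)
      (2 * β * K * (x - spinMean (spinVariance β) (2 * β * K * x))) x := by
  have h1 : HasDerivAt (fun x : ℝ => 2 * β * K * x) (2 * β * K) x := by
    simpa using (hasDerivAt_id x).const_mul (2 * β * K)
  have h2 := (hasDerivAt_spinCgf (spinVariance_pos β).le (2 * β * K * x)).comp x h1
  have h3 := ((hasDerivAt_id x).pow 2).const_mul (β * K)
  have h4 : freeEnergy β K = fun y => β * K * (id y) ^ 2 -
      (spinCgf (spinVariance β) ∘ fun x => 2 * β * K * x) y := by
    funext y
    simp [freeEnergy, cumulant_eq_spinCgf]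
  rw [h4]
  refine (h3.sub h2).congr_deriv ?_
  simp
  ring

/-- For `β ≤ β_c` and `K > K(β)`, the free energy is unimodal on the positive half line, with
a minimum point `m ∈ (0, 1)` that solves the mean-field equation. -/
theorem exists_freeEnergy_unimodal {β K : ℝ} (hβ0 : 0 < β) (hβ : β ≤ betaC)
    (hK : Kcurve β < K) :
    ∃ m, 0 < m ∧ m < 1 ∧ spinMean (spinVariance β) (2 * β * K * m) = m ∧
      StrictAntiOn (freeEnergy β K) (Set.Icc 0 m) ∧
      StrictMonoOn (freeEnergy β K) (Set.Ici m) := by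
  have hK0 : 0 < K := lt_trans (by unfold Kcurve; positivity) hK
  have hκ : 0 < 2 * β * K := by positivity
  -- The product equals `K / K(β)`.
  have haκ : 1 < spinVariance β * (2 * β * K) := by
    have he := Real.exp_pos β
    rw [Kcurve, div_lt_iff₀ (by positivity)] at hK
    rw [spinVariance, div_mul_eq_mul_div, one_lt_div (by positivity)]
    linarith
  obtain ⟨m, hm0, hm1, hm, hlt, hgt⟩ := exists_meanField_solution
    (one_third_le_spinVariance hβ) (spinVariance_lt_one β) hκ haκ
  have hc : Continuous (freeEnergy β K) :=
    continuous_iff_continuousAt.mpr fun x => (hasDerivAt_freeEnergy β K x).continuousAt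
  refine ⟨m, hm0, hm1, hm, ?_, ?_⟩
  · refine strictAntiOn_of_deriv_neg (convex_Icc 0 m) hc.continuousOn fun x hx => ?_
    rw [interior_Icc] at hx
    rw [(hasDerivAt_freeEnergy β K x).deriv]
    exact mul_neg_of_pos_of_neg hκ (by linarith [hlt x hx.1 hx.2])
  · refine strictMonoOn_of_deriv_pos (convex_Ici m) hc.continuousOn fun x hx => ?_
    rw [interior_Ici] at hx
    rw [(hasDerivAt_freeEnergy β K x).deriv]
    exact mul_pos hκ (by linarith [hgt x hx])

/-! ### Legendre duality and equilibrium macrostates -/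

/-- The line of slope `c'(s)` supports the convex function `spinCgf a` at `s`. -/
theorem mul_spinMean_sub_spinCgf_le {a : ℝ} (ha : 0 < a) (ha1 : a < 1) (s t : ℝ) :
    t * spinMean a s - spinCgf a t ≤ s * spinMean a s - spinCgf a s := by
  have hconv : ConvexOn ℝ Set.univ (spinCgf a) := by
    refine Monotone.convexOn_univ_of_deriv
      (fun t => (hasDerivAt_spinCgf ha.le t).differentiableAt) ?_
    rw [show deriv (spinCgf a) = spinMean a from funext fun t => (hasDerivAt_spinCgf ha.le t).deriv]
    exact (strictMono_spinMean ha ha1).monotone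
  have hd := hasDerivAt_spinCgf ha.le s
  rcases lt_trichotomy t s with h | h | h
  · have := hconv.slope_le_of_hasDerivAt (Set.mem_univ t) (Set.mem_univ s) h hd
    rw [slope_def_field, div_le_iff₀ (by linarith)] at this
    linarith
  · rw [h]
  · have := hconv.le_slope_of_hasDerivAt (Set.mem_univ s) (Set.mem_univ t) h hd
    rw [slope_def_field, le_div_iff₀ (by linarith)] at this
    linarith

/-- Evaluate the supremum defining `J_β` at `t = 2βKx`. -/
theorem freeEnergy_le_legendre (β K : ℝ) {x : ℝ} (hx : x ∈ Set.Icc (-1 : ℝ) 1) :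
    freeEnergy β K x ≤ legendre β x - β * K * x ^ 2 := by
  have := le_ciSup (bddAbove_legendre β hx) (2 * β * K * x)
  rw [legendre, freeEnergy]
  linarith

/-- The mean-field equation makes `t = 2βKm` a critical point of the concave function `t m -
c_β(t)`, so the supremum is attained there. -/
theorem legendre_eq_freeEnergy {β K m : ℝ} (hm : spinMean (spinVariance β) (2 * β * K * m) = m)
    (hm1 : m ∈ Set.Icc (-1 : ℝ) 1) :
    legendre β m - β * K * m ^ 2 = freeEnergy β K m := by
  refine le_antisymm ?_ (freeEnergy_le_legendre β K hm1)
  have : legendre β m ≤ 2 * β * K * m * m - cumulant β (2 * β * K * m) := by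
    refine ciSup_le fun t => ?_
    have := mul_spinMean_sub_spinCgf_le (spinVariance_pos β) (spinVariance_lt_one β)
      (2 * β * K * m) t
    rw [hm] at this
    rwa [cumulant_eq_spinCgf, cumulant_eq_spinCgf]
  rw [freeEnergy]
  linarith

theorem spinMean_neg (a t : ℝ) : spinMean a (-t) = -spinMean a t := by
  simp [spinMean, neg_div]

/-- Duality: if `±m` are the only global minimum points of the free energy, and solve the
mean-field equation, then they are the equilibrium macrostates. -/
theorem equilibria_eq_pair {β K m : ℝ} (hm : spinMean (spinVariance β) (2 * β * K * m) = m)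
    (hm1 : m ∈ Set.Icc (-1 : ℝ) 1)
    (hmin : ∀ x, x ≠ m → x ≠ -m → freeEnergy β K m < freeEnergy β K x) :
    equilibria β K = {m, -m} := by
  have hm1' : -m ∈ Set.Icc (-1 : ℝ) 1 := ⟨by linarith [hm1.2], by linarith [hm1.1]⟩
  have hm' : spinMean (spinVariance β) (2 * β * K * -m) = -m := by
    rw [mul_neg, spinMean_neg, hm]
  have hle : ∀ x, freeEnergy β K m ≤ freeEnergy β K x := by
    intro x
    by_cases h1 : x = m
    · rw [h1]
    by_cases h2 : x = -m
    · rw [h2, freeEnergy_neg]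
    exact (hmin x h1 h2).le
  have hinf : sInf ((fun y : ℝ => legendre β y - β * K * y ^ 2) '' Set.Icc (-1) 1) =
      freeEnergy β K m := by
    refine IsLeast.csInf_eq ⟨⟨m, hm1, legendre_eq_freeEnergy hm hm1⟩, ?_⟩
    rintro _ ⟨y, hy, rfl⟩
    exact (hle y).trans (freeEnergy_le_legendre β K hy)
  ext x
  simp only [equilibria, rate, hinf, Set.mem_ofPred_eq, Set.mem_insert_iff, Set.mem_singleton_iff]
  constructor
  · rintro ⟨hx, h0⟩
    by_contra! hcon
    have := hmin x hcon.1 hcon.2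
    have := freeEnergy_le_legendre β K hx
    linarith
  · rintro (rfl | rfl)
    · exact ⟨hm1, sub_eq_zero.mpr (legendre_eq_freeEnergy hm hm1)⟩
    · exact ⟨hm1', by rw [legendre_eq_freeEnergy hm' hm1', freeEnergy_neg, sub_self]⟩

/-- Phase coexistence for `0 < β ≤ β_c` and `K > K(β)`. -/
theorem magnetization_spec {β K : ℝ} (hβ0 : 0 < β) (hβ : β ≤ betaC) (hK : Kcurve β < K) :
    0 < magnetization β K ∧ equilibria β K = {magnetization β K, -magnetization β K} ∧
      StrictAntiOn (freeEnergy β K) (Set.Icc 0 (magnetization β K)) ∧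
      StrictMonoOn (freeEnergy β K) (Set.Ici (magnetization β K)) := by
  obtain ⟨m, hm0, hm1, hm, hanti, hmono⟩ := exists_freeEnergy_unimodal hβ0 hβ hK
  have hpos : ∀ x, 0 ≤ x → x ≠ m → freeEnergy β K m < freeEnergy β K x := by
    intro x hx hxm
    rcases lt_or_gt_of_ne hxm with h | h
    · exact hanti ⟨hx, h.le⟩ ⟨hm0.le, le_rfl⟩ h
    · exact hmono (Set.mem_Ici.mpr le_rfl) (Set.mem_Ici.mpr h.le) h
  have heq : equilibria β K = {m, -m} := by
    refine equilibria_eq_pair hm ⟨by linarith, hm1.le⟩ fun x h1 h2 => ?_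
    rcases le_total 0 x with h | h
    · exact hpos x h h1
    · rw [← freeEnergy_neg β K x]
      exact hpos (-x) (by linarith) fun h3 => h2 (by linarith)
  have hmag : magnetization β K = m := by
    rw [magnetization, heq]
    refine IsGreatest.csSup_eq ⟨by simp, ?_⟩
    rintro y (rfl | rfl) <;> linarith
  rw [hmag]
  exact ⟨hm0, heq, hanti, hmono⟩

/-! ### Taylor expansion of the free energy -/

/-- Averaging the exponential bounds at `t` and `-t` cancels the odd terms; the resulting constant
`7/4320` is below `1/600`. -/
theorem abs_cosh_sub_le {t : ℝ} (ht : |t| ≤ 1) :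
    |Real.cosh t - 1 - t ^ 2 / 2 - t ^ 4 / 24| ≤ t ^ 6 / 600 := by
  have h1 := Real.exp_bound ht (n := 6) (by norm_num)
  have h2 := Real.exp_bound (x := -t) (by rwa [abs_neg]) (n := 6) (by norm_num)
  have h6 : |t| ^ 6 = t ^ 6 := Even.pow_abs (by decide) t
  simp only [abs_neg, h6, Finset.sum_range_succ, Finset.sum_range_zero, Nat.factorial] at h1 h2
  norm_num at h1 h2
  rw [abs_le] at h1 h2 ⊢
  have : 0 ≤ t ^ 6 := by positivity
  rw [Real.cosh_eq]
  constructor <;> linarith [h1.1, h1.2, h2.1, h2.2]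

/-- The fourth order Taylor expansion of `spinCgf a` at `0`, uniformly in `a ∈ [0, 1]`. -/
theorem abs_spinCgf_sub_le {a t : ℝ} (ha : 0 ≤ a) (ha1 : a ≤ 1) (ht : |t| ≤ 1) :
    |spinCgf a t - (a / 2 * t ^ 2 + a * (1 - 3 * a) / 24 * t ^ 4)| ≤ 2 * t ^ 6 := by
  have hcosh := abs_cosh_sub_le ht
  set s := Real.cosh t - 1 with hs
  have hs0 : 0 ≤ s := by linarith [Real.one_le_cosh t]
  have ht2 : t ^ 2 ≤ 1 := (sq_le_one_iff_abs_le_one t).mpr ht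
  have ht0 : 0 ≤ t ^ 2 := sq_nonneg t
  have ht4 : t ^ 4 ≤ t ^ 2 := by nlinarith
  have ht6 : t ^ 6 ≤ t ^ 4 := by nlinarith
  have ht60 : 0 ≤ t ^ 6 := by positivity
  rw [abs_le] at hcosh
  have hs1 : s ≤ 11 / 20 * t ^ 2 := by linarith [hcosh.2]
  have hz0 : 0 ≤ a * s := by positivity
  have hz1 : a * s ≤ s := mul_le_of_le_one_left hs0 ha1
  have hz2 : a * s ≤ 11 / 20 := by linarith
  have hlog := Real.abs_log_sub_add_sum_range_le (x := -(a * s))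
    (by rw [abs_neg, abs_of_nonneg hz0]; linarith) 2
  rw [abs_neg, abs_of_nonneg hz0] at hlog
  -- Expand `log (1 + z) = z - z²/2 + O(z³)` at `z = a s`. The cubic tail, the replacement of `s²`
  -- by `t⁴/4`, and that of `s` by `t²/2 + t⁴/24` cost at most `t⁶`, `t⁶/2` and `t⁶/600`, in total
  -- less than `2t⁶`.
  have hcube : (a * s) ^ (2 + 1) / (1 - a * s) ≤ t ^ 6 := by
    rw [div_le_iff₀ (by linarith)]
    have : (a * s) ^ 3 ≤ (11 / 20 * t ^ 2) ^ 3 := pow_le_pow_left₀ hz0 (by linarith) 3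
    norm_num
    nlinarith
  have hlog' := hlog.trans hcube
  simp only [Finset.sum_range_succ, Finset.sum_range_zero, sub_neg_eq_add] at hlog'
  norm_num at hlog'
  have hsq : |a ^ 2 * (s - t ^ 2 / 2) * (s + t ^ 2 / 2)| ≤ t ^ 6 := by
    have h1 : |s - t ^ 2 / 2| ≤ t ^ 4 / 20 := by
      rw [abs_le]
      constructor <;> linarith [hcosh.1, hcosh.2, show 0 ≤ t ^ 4 by positivity]
    have h2 : |s + t ^ 2 / 2| ≤ 2 * t ^ 2 := by
      rw [abs_of_nonneg (by positivity)]
      linarith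
    have h3 : a ^ 2 ≤ 1 := by nlinarith
    calc |a ^ 2 * (s - t ^ 2 / 2) * (s + t ^ 2 / 2)|
        = a ^ 2 * |s - t ^ 2 / 2| * |s + t ^ 2 / 2| := by
          rw [abs_mul, abs_mul, abs_of_nonneg (sq_nonneg a)]
      _ ≤ 1 * (t ^ 4 / 20) * (2 * t ^ 2) := by gcongr
      _ ≤ t ^ 6 := by nlinarith
  have hlin : |a * (s - t ^ 2 / 2 - t ^ 4 / 24)| ≤ t ^ 6 / 600 := by
    rw [abs_mul, abs_of_nonneg ha]
    exact (mul_le_of_le_one_left (abs_nonneg _) ha1).trans (abs_le.mpr hcosh)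
  rw [spinCgf, ← hs]
  rw [abs_le] at hlog' hsq hlin ⊢
  constructor <;> nlinarith [hlog'.1, hlog'.2, hsq.1, hsq.2, hlin.1, hlin.2]

theorem abs_freeEnergy_sub_le {β K x : ℝ} (hx : |2 * β * K * x| ≤ 1) :
    |freeEnergy β K x - (β * K * (1 - 2 * spinVariance β * β * K) * x ^ 2 -
      spinVariance β * (1 - 3 * spinVariance β) / 24 * (2 * β * K) ^ 4 * x ^ 4)| ≤
      2 * (2 * β * K) ^ 6 * x ^ 6 := by
  have h := abs_spinCgf_sub_le (spinVariance_pos β).le (spinVariance_lt_one β).le hx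
  rw [freeEnergy, cumulant_eq_spinCgf, abs_sub_comm]
  convert h using 1
  · congr 1
    ring
  · ring

/-- A sequence of functions with asymptotically vanishing sixth order remainders converges
uniformly on compact sets as soon as its quadratic and quartic coefficients converge. -/
theorem tendstoUniformlyOn_of_quartic_expansion {H : ℕ → ℝ → ℝ} {A B D : ℕ → ℝ} {A₀ B₀ : ℝ}
    (hA : Tendsto A atTop (𝓝 A₀)) (hB : Tendsto B atTop (𝓝 B₀)) (hD : Tendsto D atTop (𝓝 0))
    (hH : ∀ R : ℝ, ∀ᶠ n in atTop, ∀ x, |x| ≤ R →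
      |H n x - (A n * x ^ 2 + B n * x ^ 4)| ≤ D n * x ^ 6)
    {S : Set ℝ} (hS : IsCompact S) :
    TendstoUniformlyOn H (fun x => A₀ * x ^ 2 + B₀ * x ^ 4) atTop S := by
  obtain ⟨R, hR⟩ := hS.isBounded.exists_norm_le
  rw [Metric.tendstoUniformlyOn_iff]
  intro ε hε
  have hlim : Tendsto (fun n => |A n - A₀| * R ^ 2 + |B n - B₀| * R ^ 4 + |D n| * R ^ 6) atTop
      (𝓝 0) := by
    have h1 := ((hA.sub_const A₀).abs.mul_const (R ^ 2)).add
      ((hB.sub_const B₀).abs.mul_const (R ^ 4))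
    simpa using h1.add (hD.abs.mul_const (R ^ 6))
  filter_upwards [hH R, hlim.eventually (gt_mem_nhds hε)] with n hn hsmall x hx
  have hxR : |x| ≤ R := hR x hx
  have hpow : ∀ k : ℕ, Even k → x ^ k ≤ R ^ k := fun k hk => by
    rw [← hk.pow_abs]
    gcongr
  have h2 := hpow 2 (by decide)
  have h4 := hpow 4 (by decide)
  have h6 := hpow 6 (by decide)
  rw [dist_comm, Real.dist_eq]
  calc |H n x - (A₀ * x ^ 2 + B₀ * x ^ 4)|
      = |(H n x - (A n * x ^ 2 + B n * x ^ 4)) + ((A n - A₀) * x ^ 2 + (B n - B₀) * x ^ 4)| := by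
        congr 1
        ring
    _ ≤ |H n x - (A n * x ^ 2 + B n * x ^ 4)| + (|(A n - A₀) * x ^ 2| + |(B n - B₀) * x ^ 4|) :=
        (abs_add_le _ _).trans (by gcongr; exact abs_add_le _ _)
    _ ≤ |D n| * R ^ 6 + (|A n - A₀| * R ^ 2 + |B n - B₀| * R ^ 4) := by
        rw [abs_mul, abs_mul, abs_of_nonneg (show 0 ≤ x ^ 2 by positivity),
          abs_of_nonneg (show 0 ≤ x ^ 4 by positivity)]
        have : D n * x ^ 6 ≤ |D n| * R ^ 6 :=
          (mul_le_mul_of_nonneg_right (le_abs_self _) (by positivity)).trans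
            (mul_le_mul_of_nonneg_left h6 (abs_nonneg _))
        have := hn x hxR
        gcongr
        linarith
    _ < ε := by linarith

/-! ### Asymptotics along the sequence `(β_n, K_n)` -/

theorem betaC_pos : 0 < betaC := Real.log_pos (by norm_num)

theorem exp_betaC : Real.exp betaC = 4 := Real.exp_log (by norm_num)

theorem tendsto_natCast_rpow_atTop {s : ℝ} (hs : 0 < s) :
    Tendsto (fun n : ℕ => (n : ℝ) ^ s) atTop atTop :=
  (tendsto_rpow_atTop hs).comp tendsto_natCast_atTop_atTop

theorem tendsto_one_div_rpow {α : ℝ} (hα : 0 < α) :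
    Tendsto (fun n : ℕ => 1 / (n : ℝ) ^ α) atTop (𝓝 0) := by
  exact tendsto_const_nhds.div_atTop (tendsto_natCast_rpow_atTop hα)

theorem tendsto_betaSeq {α : ℝ} (hα : 0 < α) : Tendsto (betaSeq α) atTop (𝓝 betaC) := by
  have h := (tendsto_one_div_rpow hα).const_sub betaC
  rwa [sub_zero] at h

theorem betaSeq_lt {α : ℝ} {n : ℕ} (hn : 0 < n) : betaSeq α n < betaC := by
  have : 0 < 1 / (n : ℝ) ^ α := by positivity
  rw [betaSeq]
  linarith

/-- Since `β_n - β_c = -n^(-α)`, the signs and powers of `n` are powers of this increment, which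
exposes the Taylor polynomial. -/
theorem KSeq_eq (p : ℕ) (α ℓ : ℝ) (n : ℕ) :
    KSeq p α ℓ n = Kcurve betaC
      + ∑ j ∈ Finset.Icc 1 (p - 1), KcurveDeriv j * (betaSeq α n - betaC) ^ j / (j ! : ℝ)
      + ℓ * (betaSeq α n - betaC) ^ p / (p ! : ℝ) := by
  have h : ∀ (c : ℝ) (j : ℕ), c * (-1) ^ j / ((j ! : ℝ) * (n : ℝ) ^ ((j : ℝ) * α)) =
      c * (betaSeq α n - betaC) ^ j / (j ! : ℝ) := by
    intro c j
    rw [betaSeq, sub_sub_cancel_left, mul_comm (j : ℝ) α, Real.rpow_mul_natCast n.cast_nonneg,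
      neg_pow (1 / (n : ℝ) ^ α), one_div, inv_pow, div_mul_eq_div_div, div_right_comm,
      ← mul_assoc, ← div_eq_mul_inv]
  simp only [KSeq, h]

theorem tendsto_KSeq {p : ℕ} (hp : p ≠ 0) {α : ℝ} (hα : 0 < α) (ℓ : ℝ) :
    Tendsto (KSeq p α ℓ) atTop (𝓝 (Kcurve betaC)) := by
  have hδ : Tendsto (fun n => betaSeq α n - betaC) atTop (𝓝 0) := by
    simpa using (tendsto_betaSeq hα).sub_const betaC
  have hterm : ∀ (c : ℝ) (j : ℕ), j ≠ 0 →
      Tendsto (fun n => c * (betaSeq α n - betaC) ^ j / (j ! : ℝ)) atTop (𝓝 0) := by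
    intro c j hj
    simpa [zero_pow hj] using ((hδ.pow j).const_mul c).div_const (j ! : ℝ)
  have hsum : Tendsto (fun n => ∑ j ∈ Finset.Icc 1 (p - 1),
      KcurveDeriv j * (betaSeq α n - betaC) ^ j / (j ! : ℝ)) atTop (𝓝 0) := by
    simpa using tendsto_finsetSum (Finset.Icc 1 (p - 1)) fun j hj =>
      hterm (KcurveDeriv j) j (by have := (Finset.mem_Icc.mp hj).1; omega)
  have := (hsum.const_add (Kcurve betaC)).add (hterm ℓ p hp)
  simp only [add_zero] at this
  exact this.congr fun n => (KSeq_eq p α ℓ n).symm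

theorem contDiffOn_Kcurve (p : ℕ) : ContDiffOn ℝ p Kcurve (Set.Ioi 0) := by
  unfold Kcurve
  refine ContDiffOn.div (by fun_prop) (by fun_prop) fun x hx => ?_
  have : 0 < x := hx
  positivity

/-- The gap between `K_n` and the second-order curve, to leading order. -/
theorem tendsto_Kcurve_sub_KSeq {p : ℕ} (hp : p ≠ 0) {α : ℝ} (hα : 0 < α) (ℓ : ℝ) :
    Tendsto (fun n : ℕ => (n : ℝ) ^ ((p : ℝ) * α) * (Kcurve (betaSeq α n) - KSeq p α ℓ n)) atTop
      (𝓝 ((KcurveDeriv p - ℓ) * (-1) ^ p / (p ! : ℝ))) := by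
  have hnhds : 𝓝[Set.Ioi 0] betaC = 𝓝 betaC := isOpen_Ioi.nhdsWithin_eq betaC_pos
  have ht := taylor_tendsto (convex_Ioi (0 : ℝ)) betaC_pos (contDiffOn_Kcurve p)
  rw [hnhds] at ht
  have ht' := ((ht.comp (tendsto_betaSeq hα)).add_const
    ((KcurveDeriv p - ℓ) / (p ! : ℝ))).mul_const ((-1 : ℝ) ^ p)
  rw [zero_add, div_mul_eq_mul_div] at ht'
  refine ht'.congr' ?_
  filter_upwards [eventually_gt_atTop 0] with n hn
  have hN : (0 : ℝ) < (n : ℝ) ^ α := by positivity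
  have hδ : betaSeq α n - betaC = -((n : ℝ) ^ α)⁻¹ := by rw [betaSeq]; ring
  have hδ0 : (betaSeq α n - betaC) ^ p ≠ 0 := pow_ne_zero _ (by rw [hδ]; simpa using hN.ne')
  have hNp : (n : ℝ) ^ ((p : ℝ) * α) = ((betaSeq α n - betaC) ^ p)⁻¹ * (-1) ^ p := by
    rw [mul_comm (p : ℝ) α, Real.rpow_mul_natCast n.cast_nonneg, hδ, neg_pow, mul_inv, inv_pow,
      inv_inv, ← inv_pow, inv_neg_one, mul_right_comm, ← mul_pow]
    simp
  have htaylor : taylorWithinEval Kcurve p (Set.Ioi 0) betaC (betaSeq α n) = Kcurve betaC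
      + ∑ j ∈ Finset.Icc 1 (p - 1), KcurveDeriv j * (betaSeq α n - betaC) ^ j / (j ! : ℝ)
      + KcurveDeriv p * (betaSeq α n - betaC) ^ p / (p ! : ℝ) := by
    have hterm : ∀ k : ℕ, ((k ! : ℝ)⁻¹ * (betaSeq α n - betaC) ^ k) •
        iteratedDerivWithin k Kcurve (Set.Ioi 0) betaC =
        KcurveDeriv k * (betaSeq α n - betaC) ^ k / (k ! : ℝ) := by
      intro k
      rw [iteratedDerivWithin_of_isOpen isOpen_Ioi betaC_pos, KcurveDeriv, smul_eq_mul]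
      ring
    rw [taylor_within_apply, Finset.sum_range_succ]
    simp only [hterm]
    congr 1
    -- Split off the term of order zero, which is `K(β_c)`.
    rw [Finset.range_eq_Ico, Finset.sum_eq_sum_Ico_succ_bot (Nat.pos_of_ne_zero hp)]
    congr 1
    simp [KcurveDeriv]
  simp only [Function.comp_apply, smul_eq_mul, htaylor]
  rw [hNp, KSeq_eq]
  field_simp
  ring

/-- At `β_c` one has `a = 1/3` and `a' = -2/9`, so the derivative `(1 - 6a) a'` is `2/9`. -/
theorem hasDerivAt_quarticCoeff :
    HasDerivAt (fun β => spinVariance β * (1 - 3 * spinVariance β)) (2 / 9) betaC := by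
  have h1 : HasDerivAt spinVariance (-(2 / 9)) betaC := by
    have := (hasDerivAt_const betaC (2 : ℝ)).div ((Real.hasDerivAt_exp betaC).add_const 2)
      (by positivity)
    refine this.congr_deriv ?_
    rw [exp_betaC]
    norm_num
  refine (h1.mul ((h1.const_mul 3).const_sub 1)).congr_deriv ?_
  rw [spinVariance, exp_betaC]
  norm_num

theorem tendsto_rpow_mul_quarticCoeff {α : ℝ} (hα : 0 < α) :
    Tendsto (fun n : ℕ => (n : ℝ) ^ α *
      (spinVariance (betaSeq α n) * (1 - 3 * spinVariance (betaSeq α n)))) atTop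
      (𝓝 (-(2 / 9))) := by
  have h1 : Tendsto (betaSeq α) atTop (𝓝[≠] betaC) := by
    refine tendsto_nhdsWithin_iff.mpr ⟨tendsto_betaSeq hα, ?_⟩
    filter_upwards [eventually_gt_atTop 0] with n hn
    exact (betaSeq_lt hn).ne
  refine ((hasDerivAt_quarticCoeff.tendsto_slope.comp h1).neg).congr' ?_
  filter_upwards [eventually_gt_atTop 0] with n hn
  have hN : (0 : ℝ) < (n : ℝ) ^ α := by positivity
  have hδ : betaSeq α n - betaC = -((n : ℝ) ^ α)⁻¹ := by rw [betaSeq]; ring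
  have h0 : spinVariance betaC * (1 - 3 * spinVariance betaC) = 0 := by
    rw [spinVariance, exp_betaC]
    norm_num
  rw [Function.comp_apply, slope_def_field, h0, hδ, sub_zero, div_neg, neg_neg, div_inv_eq_mul,
    mul_comm]

theorem continuousAt_spinVariance (β : ℝ) : ContinuousAt spinVariance β := by
  unfold spinVariance
  exact ContinuousAt.div (by fun_prop) (by fun_prop) (by positivity)

theorem tendsto_betaSeq_mul_KSeq {p : ℕ} (hp : p ≠ 0) {α : ℝ} (hα : 0 < α) (ℓ : ℝ) :
    Tendsto (fun n => 2 * betaSeq α n * KSeq p α ℓ n) atTop (𝓝 3) := by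
  have h := ((tendsto_betaSeq hα).const_mul 2).mul (tendsto_KSeq hp hα ℓ)
  have hb := betaC_pos
  have h3 : 2 * betaC * Kcurve betaC = 3 := by
    rw [Kcurve, exp_betaC]
    field_simp
    norm_num
  rwa [h3] at h

/-! ### Convergence of the scaled free energies -/

/-- Uniform convergence on compact sets of the scaled free energies. -/
theorem tendstoUniformlyOn_freeEnergy {p : ℕ} (hp : 3 ≤ p) {α : ℝ} (hα : 0 < α) (ℓ : ℝ)
    {S : Set ℝ} (hS : IsCompact S) :
    TendstoUniformlyOn (fun (n : ℕ) (x : ℝ) => (n : ℝ) ^ ((2 * (p : ℝ) - 1) * α) *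
        freeEnergy (betaSeq α n) (KSeq p α ℓ n) (x / (n : ℝ) ^ (((p : ℝ) - 1) * α / 2)))
      (ginzburgLandau p ℓ) atTop S := by
  have hp0 : p ≠ 0 := by omega
  have hp3 : (3 : ℝ) ≤ p := by exact_mod_cast hp
  have hκ := tendsto_betaSeq_mul_KSeq hp0 hα ℓ
  have ha := (continuousAt_spinVariance betaC).tendsto.comp (tendsto_betaSeq hα)
  set A : ℕ → ℝ := fun n => (n : ℝ) ^ ((p : ℝ) * α) * (betaSeq α n * KSeq p α ℓ n *
    (1 - 2 * spinVariance (betaSeq α n) * betaSeq α n * KSeq p α ℓ n)) with hAdef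
  set B : ℕ → ℝ := fun n => -((n : ℝ) ^ α * (spinVariance (betaSeq α n) *
    (1 - 3 * spinVariance (betaSeq α n))) / 24 * (2 * betaSeq α n * KSeq p α ℓ n) ^ 4) with hBdef
  set D : ℕ → ℝ := fun n => 2 * (2 * betaSeq α n * KSeq p α ℓ n) ^ 6 *
    (n : ℝ) ^ (-((p - 2) * α)) with hDdef
  -- As `2aβ = 1/K(β)`, the factor `1 - 2aβK` is `2aβ (K(β) - K)`; in the limit `a · 2βK` becomes
  -- `1/3 · 3 = 1`.
  have hA : Tendsto A atTop (𝓝 (1 / (p ! : ℝ) * betaC * (KcurveDeriv p - ℓ) * (-1) ^ p)) := by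
    have h1 := (((tendsto_betaSeq hα).mul ha).mul hκ).mul (tendsto_Kcurve_sub_KSeq hp0 hα ℓ)
    refine (h1.congr' ?_).trans_eq ?_
    · have hpos := (tendsto_betaSeq hα).eventually (lt_mem_nhds betaC_pos)
      filter_upwards [hpos] with n hn
      have he := Real.exp_pos (betaSeq α n)
      simp only [hAdef, Function.comp_apply, Kcurve, spinVariance]
      field_simp
      ring
    · rw [spinVariance, exp_betaC]
      congr 1
      ring
  have hB : Tendsto B atTop (𝓝 (4 * c4)) := by
    have h1 := (((tendsto_rpow_mul_quarticCoeff hα).div_const 24).mul (hκ.pow 4)).neg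
    refine h1.trans_eq ?_
    norm_num [c4]
  have hD : Tendsto D atTop (𝓝 0) := by
    -- The exponent is negative because `p > 2`.
    have h1 : Tendsto (fun n : ℕ => (n : ℝ) ^ (-(((p : ℝ) - 2) * α))) atTop (𝓝 0) :=
      (tendsto_rpow_neg_atTop (mul_pos (by linarith) hα)).comp tendsto_natCast_atTop_atTop
    simpa using ((hκ.pow 6).const_mul 2).mul h1
  refine tendstoUniformlyOn_of_quartic_expansion hA hB hD (fun R => ?_) hS
  have hγ : 0 < ((p : ℝ) - 1) * α / 2 := by
    have : 0 < (p : ℝ) - 1 := by linarith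
    positivity
  have hsmall : Tendsto (fun n : ℕ => |2 * betaSeq α n * KSeq p α ℓ n| *
      (R * (1 / (n : ℝ) ^ (((p : ℝ) - 1) * α / 2)))) atTop (𝓝 0) := by
    simpa using hκ.abs.mul ((tendsto_one_div_rpow hγ).const_mul R)
  filter_upwards [hsmall.eventually (gt_mem_nhds one_pos), eventually_gt_atTop 0]
    with n hn hn0 x hx
  have hn' : (0 : ℝ) < n := by exact_mod_cast hn0
  set r : ℝ := (n : ℝ) ^ (((p : ℝ) - 1) * α / 2) with hr
  set N : ℝ := (n : ℝ) ^ ((2 * (p : ℝ) - 1) * α) with hN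
  have hr0 : 0 < r := by positivity
  have hN0 : 0 < N := by positivity
  -- Dividing the prefactor by `r²`, `r⁴`, `r⁶` gives the powers of `n` in `A`, `B`, `D`.
  have hpow : ∀ k : ℕ, N / r ^ k =
      (n : ℝ) ^ ((2 * (p : ℝ) - 1) * α - ((p : ℝ) - 1) * α / 2 * k) := fun k => by
    rw [hN, hr, ← Real.rpow_mul_natCast hn'.le, ← Real.rpow_sub hn']
  have e2 : (n : ℝ) ^ ((p : ℝ) * α) = N / r ^ 2 := by
    rw [hpow]; congr 1; push_cast; ring
  have e4 : (n : ℝ) ^ α = N / r ^ 4 := by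
    rw [hpow]
    conv_lhs => rw [show α = (2 * (p : ℝ) - 1) * α - ((p : ℝ) - 1) * α / 2 * (4 : ℕ) by
      push_cast; ring]
  have e6 : (n : ℝ) ^ (-(((p : ℝ) - 2) * α)) = N / r ^ 6 := by
    rw [hpow]; congr 1; push_cast; ring
  have hle : |2 * betaSeq α n * KSeq p α ℓ n * (x / r)| ≤ 1 := by
    rw [abs_mul, abs_div, abs_of_pos hr0, div_eq_mul_one_div |x| r]
    exact le_trans (by gcongr) hn.le
  have hexp := mul_le_mul_of_nonneg_left (abs_freeEnergy_sub_le hle) hN0.le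
  rw [← abs_of_pos hN0, ← abs_mul, abs_of_pos hN0] at hexp
  simp only [hAdef, hBdef, hDdef, e2, e4, e6]
  clear_value r N
  refine (congrArg abs ?_).trans_le (hexp.trans_eq ?_)
  · field_simp
    ring
  · field_simp

/-! ### Minimum points of the Ginzburg-Landau polynomial -/

theorem sq_xbar {p : ℕ} {ℓ : ℝ} (h : (KcurveDeriv p - ℓ) * (-1) ^ p ≤ 0) :
    xbar p ℓ ^ 2 = betaC * (ℓ - KcurveDeriv p) * (-1) ^ p / (8 * c4 * (p ! : ℝ)) := by
  refine Real.sq_sqrt (div_nonneg ?_ (by norm_num [c4]))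
  have := mul_nonneg betaC_pos.le (neg_nonneg.mpr h)
  linarith

theorem xbar_pos {p : ℕ} {ℓ : ℝ} (h : (KcurveDeriv p - ℓ) * (-1) ^ p < 0) : 0 < xbar p ℓ := by
  refine Real.sqrt_pos.mpr (div_pos ?_ (by norm_num [c4]; positivity))
  have := mul_pos betaC_pos (neg_pos.mpr h)
  linarith

/-- Completing the square in `x²` makes the minimum points visible. -/
theorem ginzburgLandau_eq {p : ℕ} {ℓ : ℝ} (h : (KcurveDeriv p - ℓ) * (-1) ^ p ≤ 0) (x : ℝ) :
    ginzburgLandau p ℓ x = 4 * c4 * (x ^ 2 - xbar p ℓ ^ 2) ^ 2 - 4 * c4 * xbar p ℓ ^ 4 := by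
  have hA : 1 / (p ! : ℝ) * betaC * (KcurveDeriv p - ℓ) * (-1) ^ p = -(8 * c4 * xbar p ℓ ^ 2) := by
    rw [sq_xbar h, c4]
    field_simp
    ring
  rw [ginzburgLandau, hA]
  ring

theorem ginzburgLandau_lt {p : ℕ} {ℓ x : ℝ} (h : (KcurveDeriv p - ℓ) * (-1) ^ p ≤ 0)
    (hx : x ^ 2 ≠ xbar p ℓ ^ 2) : ginzburgLandau p ℓ (xbar p ℓ) < ginzburgLandau p ℓ x := by
  rw [ginzburgLandau_eq h, ginzburgLandau_eq h, sub_self]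
  have : 0 < (x ^ 2 - xbar p ℓ ^ 2) ^ 2 :=
    sq_pos_of_ne_zero (sub_ne_zero.mpr hx)
  rw [c4]
  linarith

theorem globalMinPoints_ginzburgLandau {p : ℕ} {ℓ : ℝ}
    (h : (KcurveDeriv p - ℓ) * (-1) ^ p ≤ 0) :
    globalMinPoints (ginzburgLandau p ℓ) = {xbar p ℓ, -xbar p ℓ} := by
  ext x
  simp only [globalMinPoints, Set.mem_ofPred_eq, Set.mem_insert_iff, Set.mem_singleton_iff]
  rw [← sq_eq_sq_iff_eq_or_eq_neg]
  constructor
  · intro hx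
    by_contra hne
    exact (ginzburgLandau_lt h hne).not_ge (hx _)
  · intro hx y
    rw [ginzburgLandau_eq h, ginzburgLandau_eq h, hx, sub_self]
    have := sq_nonneg (y ^ 2 - xbar p ℓ ^ 2)
    rw [c4]
    linarith

theorem exists_globalMinPoint_ne_zero_iff (p : ℕ) (ℓ : ℝ) :
    (∃ x ∈ globalMinPoints (ginzburgLandau p ℓ), x ≠ 0) ↔
      (KcurveDeriv p - ℓ) * (-1) ^ p < 0 := by
  constructor
  · rintro ⟨x, hx, hx0⟩
    by_contra! hcon
    have h := hx 0
    -- With a nonnegative quadratic coefficient, `g(x) ≥ 4 c₄ x⁴ > 0 = g(0)`.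
    have h1 : 0 ≤ 1 / (p ! : ℝ) * betaC * (KcurveDeriv p - ℓ) * (-1) ^ p * x ^ 2 := by
      rw [mul_assoc _ (KcurveDeriv p - ℓ)]
      have := betaC_pos
      positivity
    have h2 : 0 < x ^ 4 := by positivity
    simp only [ginzburgLandau, c4] at h
    norm_num at h h1
    linarith
  · intro h
    refine ⟨xbar p ℓ, ?_, (xbar_pos h).ne'⟩
    rw [globalMinPoints_ginzburgLandau h.le]
    exact Set.mem_insert _ _

/-! ### Asymptotics of the magnetization -/

/-- The scaled minimum points of unimodal functions on `[0, ∞)` converge to the unique minimum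
point of the pointwise limit of the scaled functions. -/
theorem tendsto_scaled_minPoint {G : ℕ → ℝ → ℝ} {c r m : ℕ → ℝ} {g : ℝ → ℝ} {z : ℝ}
    (hpos : ∀ᶠ n in atTop, 0 < c n ∧ 0 < r n)
    (hm : ∀ᶠ n in atTop, 0 ≤ m n ∧ StrictAntiOn (G n) (Set.Icc 0 (m n)) ∧
      StrictMonoOn (G n) (Set.Ici (m n)))
    (hlim : ∀ x, Tendsto (fun n => c n * G n (x / r n)) atTop (𝓝 (g x)))
    (hz : 0 < z) (hg : ∀ x, 0 ≤ x → x ≠ z → g z < g x) :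
    Tendsto (fun n => r n * m n) atTop (𝓝 z) := by
  have hcomp : ∀ x, 0 ≤ x → x ≠ z →
      ∀ᶠ n in atTop, c n * G n (z / r n) < c n * G n (x / r n) := fun x hx hxz =>
    (hlim z).eventually_lt (hlim x) (hg x hx hxz)
  refine tendsto_order.mpr ⟨fun a ha => ?_, fun b hb => ?_⟩
  -- If `r m ≤ a`, then `G` increases from `max a 0 / r` to `z / r`, against the comparison of
  -- values inherited from `g`. Truncation at `0` keeps the comparison point in the range of `hg`.
  · have ha' : max a 0 < z := max_lt ha hz
    filter_upwards [hpos, hm, hcomp _ (le_max_right a 0) ha'.ne] with n ⟨hc, hr⟩ ⟨_, _, hmono⟩ h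
    by_contra! hle
    have h1 : m n ≤ max a 0 / r n := by
      rw [le_div_iff₀ hr, mul_comm]
      exact hle.trans (le_max_left a 0)
    have h2 : max a 0 / r n < z / r n := by gcongr
    exact (lt_of_mul_lt_mul_left h hc.le).not_gt
      (hmono (Set.mem_Ici.mpr h1) (Set.mem_Ici.mpr (h1.trans h2.le)) h2)
  -- Symmetrically, if `r m ≥ b`, then `G` decreases from `z / r` to `b / r`.
  · filter_upwards [hpos, hm, hcomp b (hz.trans hb).le hb.ne'] with n ⟨hc, hr⟩ ⟨_, hanti, _⟩ h
    by_contra! hle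
    have h1 : b / r n ≤ m n := by
      rwa [div_le_iff₀ hr, mul_comm]
    have h2 : z / r n < b / r n := by gcongr
    have h3 : 0 < z / r n := by positivity
    exact (lt_of_mul_lt_mul_left h hc.le).not_gt
      (hanti ⟨h3.le, h2.le.trans h1⟩ ⟨h3.le.trans h2.le, h1⟩ h2)

theorem eventually_Kcurve_lt_KSeq {p : ℕ} (hp : p ≠ 0) {α : ℝ} (hα : 0 < α) {ℓ : ℝ}
    (h : (KcurveDeriv p - ℓ) * (-1) ^ p < 0) :
    ∀ᶠ n : ℕ in atTop, Kcurve (betaSeq α n) < KSeq p α ℓ n := by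
  have hneg : (KcurveDeriv p - ℓ) * (-1) ^ p / (p ! : ℝ) < 0 :=
    div_neg_of_neg_of_pos h (by positivity)
  filter_upwards [(tendsto_Kcurve_sub_KSeq hp hα ℓ).eventually (gt_mem_nhds hneg),
    eventually_gt_atTop 0] with n hn hn0
  have hN : (0 : ℝ) < (n : ℝ) ^ ((p : ℝ) * α) := by positivity
  exact sub_neg.mp ((pos_iff_neg_of_mul_neg hn).mp hN)

theorem eventually_magnetization_spec {p : ℕ} (hp : p ≠ 0) {α : ℝ} (hα : 0 < α) {ℓ : ℝ}
    (h : (KcurveDeriv p - ℓ) * (-1) ^ p < 0) :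
    ∀ᶠ n : ℕ in atTop, 0 < magnetization (betaSeq α n) (KSeq p α ℓ n) ∧
      equilibria (betaSeq α n) (KSeq p α ℓ n) =
        {magnetization (betaSeq α n) (KSeq p α ℓ n),
          -magnetization (betaSeq α n) (KSeq p α ℓ n)} ∧
      StrictAntiOn (freeEnergy (betaSeq α n) (KSeq p α ℓ n))
        (Set.Icc 0 (magnetization (betaSeq α n) (KSeq p α ℓ n))) ∧
      StrictMonoOn (freeEnergy (betaSeq α n) (KSeq p α ℓ n))
        (Set.Ici (magnetization (betaSeq α n) (KSeq p α ℓ n))) := by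
  filter_upwards [eventually_Kcurve_lt_KSeq hp hα h, eventually_gt_atTop 0,
    (tendsto_betaSeq hα).eventually (lt_mem_nhds betaC_pos)] with n hK hn hβ
  exact magnetization_spec hβ (betaSeq_lt hn).le hK

theorem tendsto_scaled_magnetization {p : ℕ} (hp : 3 ≤ p) {α : ℝ} (hα : 0 < α) {ℓ : ℝ}
    (h : (KcurveDeriv p - ℓ) * (-1) ^ p < 0) :
    Tendsto (fun n : ℕ => (n : ℝ) ^ (((p : ℝ) - 1) * α / 2) *
      magnetization (betaSeq α n) (KSeq p α ℓ n)) atTop (𝓝 (xbar p ℓ)) := by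
  refine tendsto_scaled_minPoint (G := fun n => freeEnergy (betaSeq α n) (KSeq p α ℓ n))
    (c := fun n => (n : ℝ) ^ ((2 * (p : ℝ) - 1) * α)) (g := ginzburgLandau p ℓ) ?_ ?_
    (fun x => ?_) (xbar_pos h) fun x hx hne => ?_
  · filter_upwards [eventually_gt_atTop 0] with n hn
    exact ⟨by positivity, by positivity⟩
  · filter_upwards [eventually_magnetization_spec (by omega) hα h] with n hn
    exact ⟨hn.1.le, hn.2.2⟩
  · exact (tendstoUniformlyOn_freeEnergy hp hα ℓ isCompact_singleton).tendsto_at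
      (Set.mem_singleton x)
  · exact ginzburgLandau_lt h.le fun he =>
      hne ((pow_left_inj₀ hx (xbar_pos h).le two_ne_zero).mp he)

theorem isEquivalent_of_tendsto_mul {r m : ℕ → ℝ} {z : ℝ} (hz : z ≠ 0)
    (h : Tendsto (fun n => r n * m n) atTop (𝓝 z)) :
    Asymptotics.IsEquivalent atTop m (fun n => z / r n) := by
  refine Asymptotics.isEquivalent_of_tendsto_one ?_
  have h1 := h.div_const z
  rw [div_self hz] at h1
  refine h1.congr fun n => ?_
  simp only [Pi.div_apply]
  rw [div_div_eq_mul_div, mul_comm]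

theorem betaC_sub_betaSeq_rpow (α s : ℝ) (n : ℕ) :
    (betaC - betaSeq α n) ^ s = 1 / (n : ℝ) ^ (s * α) := by
  rw [betaSeq, sub_sub_cancel, one_div, Real.inv_rpow (by positivity), ← Real.rpow_mul
    n.cast_nonneg, one_div, mul_comm]

end BlumeCapel

theorem theorem5p4 (p : ℕ) (hp : 3 ≤ p) (α : ℝ) (hα : 0 < α) (ℓ : ℝ)
    (hℓ : ℓ ≠ BlumeCapel.KcurveDeriv p) :
    -- convergence to the tricritical point
    Tendsto (fun n : ℕ => (BlumeCapel.betaSeq α n, BlumeCapel.KSeq p α ℓ n)) atTop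
        (𝓝 (BlumeCapel.betaC, BlumeCapel.Kcurve BlumeCapel.betaC)) ∧
    -- (a) convergence of the scaled free-energy functionals, uniformly on compact sets
    (∀ u γ : ℝ, u = 1 - (2 * (p : ℝ) - 1) * α → γ = ((p : ℝ) - 1) * α / 2 →
      ∀ S : Set ℝ, IsCompact S →
        TendstoUniformlyOn
          (fun (n : ℕ) (x : ℝ) => (n : ℝ) ^ (1 - u) *
            BlumeCapel.freeEnergy (BlumeCapel.betaSeq α n) (BlumeCapel.KSeq p α ℓ n)
              (x / (n : ℝ) ^ γ))
          (BlumeCapel.ginzburgLandau p ℓ) atTop S) ∧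
    -- (b) global minimum points of the Ginzburg-Landau polynomial
    ((∃ x ∈ BlumeCapel.globalMinPoints (BlumeCapel.ginzburgLandau p ℓ), x ≠ 0) ↔
      (BlumeCapel.KcurveDeriv p - ℓ) * (-1) ^ p < 0) ∧
    ((BlumeCapel.KcurveDeriv p - ℓ) * (-1) ^ p < 0 →
      BlumeCapel.globalMinPoints (BlumeCapel.ginzburgLandau p ℓ) =
        {BlumeCapel.xbar p ℓ, -BlumeCapel.xbar p ℓ}) ∧
    -- (c) phase coexistence for large `n`, and asymptotics of the magnetization
    ((BlumeCapel.KcurveDeriv p - ℓ) * (-1) ^ p < 0 →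
      (∀ᶠ n : ℕ in atTop,
        BlumeCapel.Kcurve (BlumeCapel.betaSeq α n) < BlumeCapel.KSeq p α ℓ n ∧
        0 < BlumeCapel.magnetization (BlumeCapel.betaSeq α n) (BlumeCapel.KSeq p α ℓ n) ∧
        BlumeCapel.equilibria (BlumeCapel.betaSeq α n) (BlumeCapel.KSeq p α ℓ n) =
          {BlumeCapel.magnetization (BlumeCapel.betaSeq α n) (BlumeCapel.KSeq p α ℓ n),
            -BlumeCapel.magnetization (BlumeCapel.betaSeq α n) (BlumeCapel.KSeq p α ℓ n)}) ∧
      Tendsto (fun n : ℕ =>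
          BlumeCapel.magnetization (BlumeCapel.betaSeq α n) (BlumeCapel.KSeq p α ℓ n))
        atTop (𝓝 0) ∧
      Tendsto (fun n : ℕ => (n : ℝ) ^ (((p : ℝ) - 1) * α / 2) *
          BlumeCapel.magnetization (BlumeCapel.betaSeq α n) (BlumeCapel.KSeq p α ℓ n))
        atTop (𝓝 (BlumeCapel.xbar p ℓ)) ∧
      Asymptotics.IsEquivalent atTop
        (fun n : ℕ =>
          BlumeCapel.magnetization (BlumeCapel.betaSeq α n) (BlumeCapel.KSeq p α ℓ n))
        (fun n : ℕ => BlumeCapel.xbar p ℓ / (n : ℝ) ^ (((p : ℝ) - 1) * α / 2)) ∧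
      Asymptotics.IsEquivalent atTop
        (fun n : ℕ =>
          BlumeCapel.magnetization (BlumeCapel.betaSeq α n) (BlumeCapel.KSeq p α ℓ n))
        (fun n : ℕ => BlumeCapel.xbar p ℓ *
          (BlumeCapel.betaC - BlumeCapel.betaSeq α n) ^ (((p : ℝ) - 1) / 2))) := by
  open BlumeCapel in
  have hp0 : p ≠ 0 := by omega
  have hp3 : (3 : ℝ) ≤ p := by exact_mod_cast hp
  refine ⟨(tendsto_betaSeq hα).prodMk_nhds (tendsto_KSeq hp0 hα ℓ), ?_,
    exists_globalMinPoint_ne_zero_iff p ℓ, fun h => globalMinPoints_ginzburgLandau h.le,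
    fun h => ?_⟩
  · rintro u γ rfl rfl S hS
    simpa only [sub_sub_cancel] using tendstoUniformlyOn_freeEnergy hp hα ℓ hS
  · have hγ : 0 < ((p : ℝ) - 1) * α / 2 := by
      have : 0 < (p : ℝ) - 1 := by linarith
      positivity
    have hlim := tendsto_scaled_magnetization hp hα h
    have hequiv := isEquivalent_of_tendsto_mul (xbar_pos h).ne' hlim
    refine ⟨?_, ?_, hlim, hequiv, ?_⟩
    · filter_upwards [eventually_Kcurve_lt_KSeq hp0 hα h, eventually_magnetization_spec hp0 hα h]
        with n h1 h2
      exact ⟨h1, h2.1, h2.2.1⟩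
    · exact hequiv.symm.tendsto_nhds
        (tendsto_const_nhds.div_atTop (tendsto_natCast_rpow_atTop hγ))
    · refine hequiv.congr_right (Eventually.of_forall fun n => ?_)
      simp only [betaC_sub_betaSeq_rpow, mul_one_div]
      congr 2
      ring
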